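/- **Theorem 1.** Let $a,b,c,d\in\mathbb{C}$ be such that none of $a,\ b,\ c,\ d,\ a+b+c+d-1$ is a non-positive integer. Put $$\Phi(a,b;c,d)=\sum_{k=0}^{\infty}\frac{\Gamma(a+k)\,\Gamma(b+k)\,\Gamma(a+b+c+d-1+k)}{\Gamma(1+k)\,\Gamma(a+b+c+k)\,\Gamma(a+b+d+k)},$$ where $1/\Gamma$ denotes the entire reciprocal gamma function (so $1/\Gamma(z)=0$ for $z=0,-1,-2,\dots$). Then the series defining $\Phi(a,b;c,d)$ and $\Phi(c,d;a,b)$ converge absolutely, and $$\Phi(a,b;c,d)+\Phi(c,d;a,b)=\frac{\Gamma(a)\,\Gamma(b)\,\Gamma(c)\,\Gamma(d)\,\Gamma(a+b+c+d-1)}{\Gamma(a+c)\,\Gamma(a+d)\,\Gamma(b+c)\,\Gamma(b+d)}.$$ -/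

import Mathlib

/-- The `k`-th term of the series `Φ(a,b;c,d)`. Since `Complex.Gamma` vanishes at its poles and
`x / 0 = 0`, a pole of a gamma factor in the denominator makes the term `0`, in accordance with
the convention that `1/Γ` is the entire reciprocal gamma function. -/
noncomputable def PhiTerm (a b c d : ℂ) (k : ℕ) : ℂ :=
  (Complex.Gamma (a + k) * Complex.Gamma (b + k) * Complex.Gamma (a + b + c + d - 1 + k)) /
    (Complex.Gamma (1 + k) * Complex.Gamma (a + b + c + k) * Complex.Gamma (a + b + d + k))

/-- `Φ(a,b;c,d)`, the sum of the series. -/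
noncomputable def Phi (a b c d : ℂ) : ℂ :=
  ∑' k : ℕ, PhiTerm a b c d k

/-!
Write `s = a + b + c + d` and `T(a,b,c,d) = Φ(a,b;c,d) + Φ(c,d;a,b)`. Both `T` and the product of
gamma functions `R` that evaluates it satisfy the same first-order recurrence in `a`,

  `(a+c)(a+d) T(a+1) = a(s-1) T(a)`,

and the same asymptotics as `a → ∞`, hence they agree.

* The recurrence is found by Gosper's algorithm. With `t₁`, `t₂` the terms of the two series,
  `(a+c)(a+d) tᵢ(a+1) - a(s-1) tᵢ(a)` is the difference of `G₁(k) = -(a+s-1+k) k t₁(k)` for the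
  first series and of `G₂(k) = k (b+c+d-1+k) t₂(k)` for the second
  (`PhiTerm_telescope_left`, `PhiTerm_telescope_right`). The two series are balanced, so
  `k² tᵢ(k) → 1` (`tendsto_sq_mul_PhiTerm`); this gives absolute convergence, and it shows that
  `G₁ → -1` and `G₂ → 1`. These two boundary terms cancel in the sum (`Phi_add_Phi_shift`).
* When `Re b ≥ 1`, as `n → ∞` one has `n^(1-b) Φ(a+n,b;c,d) → 0`, whereas
  `n^(1-b) Φ(c,d;a+n,b)` tends to Gauss's sum `∑ Γ(c+k) Γ(d+k) / (k! Γ(b+c+d+k))`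
  (`tendsto_Phi_add_nat_mul_cpow`, `tendsto_Phi_right_add_nat_mul_cpow`). Gauss's theorem
  (`tsum_gaussTerm`) is proved by the same method, with a telescoping recurrence in `b`.
* General parameters are reduced to real parts `≥ 1` by running the recurrence backwards in each of
  the four parameters, using the symmetries `a ↔ b` and `(a,b) ↔ (c,d)` of `T` and `R`.

All growth estimates come from `Γ(z+n) / Γ(w+n) ~ n^(z-w)` (`Complex.tendsto_Gamma_ratio`). The
recurrences are derived from `1/Γ(z) = z · 1/Γ(z+1)`, valid for every `z` under the convention
`0⁻¹ = 0`, so that parameters with a pole of a gamma factor in a denominator are not exceptional.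
-/

open Filter Topology

/-! ### Asymptotics of quotients of gamma functions -/

theorem Complex.inv_Gamma_eq_mul_inv_Gamma_add_one (z : ℂ) :
    (Complex.Gamma z)⁻¹ = z * (Complex.Gamma (z + 1))⁻¹ :=
  Complex.one_div_Gamma_eq_self_mul_one_div_Gamma_add_one z

theorem Complex.inv_Gamma_one_add_natCast_succ (k : ℕ) :
    (Complex.Gamma (1 + (k + 1 : ℕ)))⁻¹ = (Complex.Gamma (1 + k))⁻¹ / (k + 1) := by
  rw [Nat.cast_succ, add_comm (1 : ℂ), Complex.Gamma_add_one _ (Nat.cast_add_one_ne_zero k),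
    mul_inv, add_comm (k : ℂ), div_eq_mul_inv, mul_comm]

theorem tendsto_add_natCast_div_natCast (z : ℂ) :
    Tendsto (fun n : ℕ => (z + n) / (n : ℂ)) atTop (𝓝 1) := by
  have h : Tendsto (fun n : ℕ => z * ((n : ℂ))⁻¹ + 1) atTop (𝓝 (z * 0 + 1)) :=
    (tendsto_const_nhds.mul (tendsto_inv_atTop_nhds_zero_nat (𝕜 := ℂ))).add tendsto_const_nhds
  simp only [mul_zero, zero_add] at h
  refine h.congr' ?_
  filter_upwards [eventually_ne_atTop 0] with n hn
  have : (n : ℂ) ≠ 0 := Nat.cast_ne_zero.mpr hn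
  field_simp

/-- Gauss's limit formula for `Γ`, restated for `1 / Γ(z + n)`; unlike that formula it has content
also when `z` is a pole of `Γ`, a case reached by descending from `Re z > 0`. -/
theorem Complex.tendsto_inv_Gamma_add_nat (z : ℂ) :
    Tendsto (fun n : ℕ => (Complex.Gamma (z + n))⁻¹ * (n.factorial : ℂ) * (n : ℂ) ^ (z - 1))
      atTop (𝓝 1) := by
  obtain ⟨m, hm⟩ := exists_nat_gt (-z.re)
  induction m generalizing z with
  | zero =>
    have hz : 0 < z.re := by simpa using hm
    have hp : ∀ k : ℕ, z ≠ -k := by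
      rintro k rfl
      simp only [Complex.neg_re, Complex.natCast_re] at hz
      have : (0 : ℝ) ≤ k := k.cast_nonneg
      linarith
    have hG := Complex.Gamma_ne_zero hp
    have hk : ∀ k : ℕ, z + k ≠ 0 := fun k h => hp k (eq_neg_of_add_eq_zero_left h)
    have h := ((Complex.GammaSeq_tendsto_Gamma z).div_const (Complex.Gamma z)).mul
      (tendsto_add_natCast_div_natCast z)
    rw [div_self hG, mul_one] at h
    refine h.congr' ?_
    filter_upwards [eventually_ne_atTop 0] with n hn
    have hn' : (n : ℂ) ≠ 0 := Nat.cast_ne_zero.mpr hn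
    have hprod : ∀ n : ℕ, Complex.Gamma (z + n) =
        (∏ j ∈ Finset.range n, (z + j)) * Complex.Gamma z := by
      intro n
      induction n with
      | zero => simp
      | succ n ih =>
        rw [Finset.prod_range_succ, Nat.cast_succ, ← add_assoc, Complex.Gamma_add_one _ (hk n), ih]
        ring
    have hpr : ∏ j ∈ Finset.range n, (z + j) ≠ 0 := Finset.prod_ne_zero_iff.mpr fun j _ => hk j
    rw [hprod, Complex.GammaSeq, Finset.prod_range_succ, Complex.cpow_sub _ _ hn', Complex.cpow_one]
    have := hk n
    field_simp
  | succ m ih =>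
    have h := (ih (z + 1) (by simp at hm ⊢; linarith)).mul (tendsto_add_natCast_div_natCast z)
    rw [mul_one] at h
    refine h.congr' ?_
    filter_upwards [eventually_ne_atTop 0] with n hn
    have hn' : (n : ℂ) ≠ 0 := Nat.cast_ne_zero.mpr hn
    rw [Complex.inv_Gamma_eq_mul_inv_Gamma_add_one (z + n), add_sub_cancel_right,
      Complex.cpow_sub _ _ hn', Complex.cpow_one, add_right_comm]
    field_simp

/-- `Γ(z + n) / Γ(w + n) ~ n ^ (z - w)` as `n → ∞`. -/
theorem Complex.tendsto_Gamma_ratio (z w : ℂ) :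
    Tendsto (fun n : ℕ => Complex.Gamma (z + n) * (Complex.Gamma (w + n))⁻¹ * (n : ℂ) ^ (w - z))
      atTop (𝓝 1) := by
  have h := (Complex.tendsto_inv_Gamma_add_nat w).div (Complex.tendsto_inv_Gamma_add_nat z)
    one_ne_zero
  rw [div_one] at h
  refine h.congr' ?_
  filter_upwards [eventually_ne_atTop 0] with n hn
  have hn' : (n : ℂ) ≠ 0 := Nat.cast_ne_zero.mpr hn
  have hf : (n.factorial : ℂ) ≠ 0 := Nat.cast_ne_zero.mpr n.factorial_ne_zero
  have hz : (n : ℂ) ^ z ≠ 0 := by simp [Complex.cpow_eq_zero_iff, hn]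
  simp only [Pi.div_apply]
  rw [Complex.cpow_sub _ _ hn', Complex.cpow_sub _ _ hn', Complex.cpow_sub _ _ hn',
    Complex.cpow_one]
  rw [div_eq_mul_inv, mul_inv, mul_inv, inv_inv]
  field_simp

/-- The power is one of `n + 1` rather than of `n`, so that the bound includes `n = 0`. -/
theorem Complex.exists_norm_Gamma_ratio_le (z w : ℂ) :
    ∃ C : ℝ, 0 ≤ C ∧ ∀ n : ℕ, ‖Complex.Gamma (z + n) * (Complex.Gamma (w + n))⁻¹‖ ≤
      C * ((n : ℝ) + 1) ^ (z.re - w.re) := by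
  have h1 : Tendsto (fun n : ℕ => ((n : ℝ) / ((n : ℝ) + 1)) ^ (z.re - w.re)) atTop (𝓝 1) := by
    have := (tendsto_natCast_div_add_atTop (1 : ℝ)).rpow_const (p := z.re - w.re)
      (Or.inl one_ne_zero)
    simpa using this
  have h2 := (Complex.tendsto_Gamma_ratio z w).norm.mul h1
  obtain ⟨C, hC⟩ := h2.bddAbove_range
  have hC' : ∀ n : ℕ, n ≠ 0 → ‖Complex.Gamma (z + n) * (Complex.Gamma (w + n))⁻¹‖ ≤
      C * ((n : ℝ) + 1) ^ (z.re - w.re) := by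
    intro n hn
    have hn0 : (0 : ℝ) < n := by positivity
    have := hC ⟨n, rfl⟩
    simp only at this
    rw [norm_mul, Complex.norm_natCast_cpow_of_pos (Nat.pos_of_ne_zero hn), mul_assoc,
      Real.div_rpow hn0.le (by positivity)] at this
    have e : (n : ℝ) ^ (w - z).re * ((n : ℝ) ^ (z.re - w.re) / ((n : ℝ) + 1) ^ (z.re - w.re)) =
        (((n : ℝ) + 1) ^ (z.re - w.re))⁻¹ := by
      rw [← mul_div_assoc, ← Real.rpow_add hn0]
      simp
    rw [e, ← div_eq_mul_inv, div_le_iff₀ (by positivity)] at this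
    exact this
  refine ⟨max (max C 0) ‖Complex.Gamma z * (Complex.Gamma w)⁻¹‖, by positivity, fun n => ?_⟩
  rcases eq_or_ne n 0 with rfl | hn
  · simp
  · exact (hC' n hn).trans (by gcongr; exact (le_max_left _ _).trans (le_max_left _ _))

/-! ### Telescoping recurrences -/

theorem tsum_eq_of_telescoping {f G : ℕ → ℂ} {L : ℂ} (hf : Summable f)
    (hG : ∀ k, f k = G (k + 1) - G k) (h0 : G 0 = 0) (hL : Tendsto G atTop (𝓝 L)) :
    ∑' k, f k = L := by
  refine tendsto_nhds_unique hf.hasSum.tendsto_sum_nat (hL.congr fun n => ?_)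
  simp_rw [hG, Finset.sum_range_sub, h0, sub_zero]

/-- The series is balanced: the parameters in the denominator exceed those in the numerator by `2`
in total (counting the `1` of `Γ(1 + k)`), whatever `a, b, c, d` are. -/
theorem tendsto_sq_mul_PhiTerm (a b c d : ℂ) :
    Tendsto (fun k : ℕ => (k : ℂ) ^ 2 * PhiTerm a b c d k) atTop (𝓝 1) := by
  have h := ((Complex.tendsto_Gamma_ratio a 1).mul
    (Complex.tendsto_Gamma_ratio b (a + b + c))).mul
    (Complex.tendsto_Gamma_ratio (a + b + c + d - 1) (a + b + d))
  rw [one_mul, one_mul] at h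
  refine h.congr' ?_
  filter_upwards [eventually_ne_atTop 0] with n hn
  have hn' : (n : ℂ) ≠ 0 := Nat.cast_ne_zero.mpr hn
  have e : (n : ℂ) ^ 2 = (n : ℂ) ^ (1 - a) * (n : ℂ) ^ (a + b + c - b) *
      (n : ℂ) ^ (a + b + d - (a + b + c + d - 1)) := by
    rw [← Complex.cpow_add _ _ hn', ← Complex.cpow_add _ _ hn', ← Complex.cpow_natCast]
    congr 1
    push_cast
    ring
  rw [PhiTerm, e, div_eq_mul_inv, mul_inv, mul_inv]
  ring

theorem summable_PhiTerm (a b c d : ℂ) : Summable (PhiTerm a b c d) := by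
  have h2 : Summable fun k : ℕ => 1 / (k : ℝ) ^ 2 := Real.summable_one_div_nat_pow.mpr one_lt_two
  refine summable_of_isBigO_nat h2 ?_
  obtain ⟨C, hC⟩ := (tendsto_sq_mul_PhiTerm a b c d).norm.bddAbove_range
  refine Asymptotics.IsBigO.of_bound C ?_
  filter_upwards [eventually_ne_atTop 0] with n hn
  have := hC ⟨n, rfl⟩
  simp only [norm_mul, norm_pow, Complex.norm_natCast] at this
  have hn0 : (0 : ℝ) < n := by positivity
  rw [Real.norm_of_nonneg (by positivity), mul_one_div, le_div_iff₀ (by positivity), mul_comm]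
  exact this

theorem PhiTerm_swap_left (a b c d : ℂ) : PhiTerm a b c d = PhiTerm b a c d := by
  funext k
  simp only [PhiTerm]
  rw [add_comm b a]
  ring

theorem PhiTerm_swap_right (a b c d : ℂ) : PhiTerm a b c d = PhiTerm a b d c := by
  funext k
  simp only [PhiTerm]
  rw [add_right_comm (a + b) c d]
  ring

theorem PhiTerm_telescope_left {a b c d : ℂ} (ha : ∀ n : ℕ, a ≠ -(n : ℂ))
    (hb : ∀ n : ℕ, b ≠ -(n : ℂ)) (hs : ∀ n : ℕ, a + b + c + d - 1 ≠ -(n : ℂ)) (k : ℕ) :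
    (a + c) * (a + d) * PhiTerm (a + 1) b c d k
        - a * (a + b + c + d - 1) * PhiTerm a b c d k =
      -(a + (a + b + c + d - 1) + (k + 1 : ℕ)) * (k + 1 : ℕ) * PhiTerm a b c d (k + 1)
        - -(a + (a + b + c + d - 1) + k) * k * PhiTerm a b c d k := by
  have ha' : a + k ≠ 0 := fun h => ha k (eq_neg_of_add_eq_zero_left h)
  have hb' : b + k ≠ 0 := fun h => hb k (eq_neg_of_add_eq_zero_left h)
  have hs' : a + b + c + d - 1 + k ≠ 0 := fun h => hs k (eq_neg_of_add_eq_zero_left h)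
  have hk : (k : ℂ) + 1 ≠ 0 := Nat.cast_add_one_ne_zero k
  have e1 := Complex.inv_Gamma_one_add_natCast_succ k
  have e2 := Complex.inv_Gamma_eq_mul_inv_Gamma_add_one (a + b + c + k)
  have e3 := Complex.inv_Gamma_eq_mul_inv_Gamma_add_one (a + b + d + k)
  simp only [PhiTerm, div_eq_mul_inv, mul_inv, e1, e2, e3]
  rw [show a + 1 + (k : ℂ) = a + k + 1 by ring,
    show a + 1 + b + c + d - 1 + (k : ℂ) = a + b + c + d - 1 + k + 1 by ring,
    show a + 1 + b + c + (k : ℂ) = a + b + c + k + 1 by ring,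
    show a + 1 + b + d + (k : ℂ) = a + b + d + k + 1 by ring]
  simp only [Nat.cast_succ, ← add_assoc]
  rw [Complex.Gamma_add_one _ ha', Complex.Gamma_add_one _ hb', Complex.Gamma_add_one _ hs']
  field_simp
  ring

theorem PhiTerm_telescope_right {a b c d : ℂ} (hc : ∀ n : ℕ, c ≠ -(n : ℂ))
    (hd : ∀ n : ℕ, d ≠ -(n : ℂ)) (hs : ∀ n : ℕ, a + b + c + d - 1 ≠ -(n : ℂ)) (k : ℕ) :
    (a + c) * (a + d) * PhiTerm c d (a + 1) b k
        - a * (a + b + c + d - 1) * PhiTerm c d a b k =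
      (k + 1 : ℕ) * (b + c + d - 1 + (k + 1 : ℕ)) * PhiTerm c d a b (k + 1)
        - k * (b + c + d - 1 + k) * PhiTerm c d a b k := by
  have hc' : c + k ≠ 0 := fun h => hc k (eq_neg_of_add_eq_zero_left h)
  have hd' : d + k ≠ 0 := fun h => hd k (eq_neg_of_add_eq_zero_left h)
  have hs' : a + b + c + d - 1 + k ≠ 0 := fun h => hs k (eq_neg_of_add_eq_zero_left h)
  have hk : (k : ℂ) + 1 ≠ 0 := Nat.cast_add_one_ne_zero k
  have e1 := Complex.inv_Gamma_one_add_natCast_succ k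
  have e2 := Complex.inv_Gamma_eq_mul_inv_Gamma_add_one (c + d + a + k)
  have e3 := Complex.inv_Gamma_eq_mul_inv_Gamma_add_one (c + d + b + k)
  simp only [PhiTerm, div_eq_mul_inv, mul_inv, e1]
  rw [show c + d + (a + 1) + b - 1 + (k : ℂ) = a + b + c + d - 1 + k + 1 by ring,
    show c + d + a + b - 1 + (k : ℂ) = a + b + c + d - 1 + k by ring,
    show c + d + a + b - 1 + ((k + 1 : ℕ) : ℂ) = a + b + c + d - 1 + k + 1 by push_cast; ring,
    show c + d + (a + 1) + (k : ℂ) = c + d + a + k + 1 by ring]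
  simp only [Nat.cast_succ, ← add_assoc]
  rw [Complex.Gamma_add_one _ hc', Complex.Gamma_add_one _ hd', Complex.Gamma_add_one _ hs', e2, e3]
  field_simp
  ring

/-- The value `-1` is the limit at infinity of the Gosper antidifference
`-(a + (a+b+c+d-1) + k) k t(k)`, since `k² t(k) → 1`. -/
theorem Phi_shift_left {a b c d : ℂ} (ha : ∀ n : ℕ, a ≠ -(n : ℂ))
    (hb : ∀ n : ℕ, b ≠ -(n : ℂ)) (hs : ∀ n : ℕ, a + b + c + d - 1 ≠ -(n : ℂ)) :
    (a + c) * (a + d) * Phi (a + 1) b c d - a * (a + b + c + d - 1) * Phi a b c d = -1 := by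
  have s1 := (summable_PhiTerm (a + 1) b c d).mul_left ((a + c) * (a + d))
  have s2 := (summable_PhiTerm a b c d).mul_left (a * (a + b + c + d - 1))
  rw [Phi, Phi, ← tsum_mul_left, ← tsum_mul_left, ← s1.tsum_sub s2]
  refine tsum_eq_of_telescoping (s1.sub s2)
    (G := fun k : ℕ => -(a + (a + b + c + d - 1) + k) * k * PhiTerm a b c d k)
    (PhiTerm_telescope_left ha hb hs) (by simp) ?_
  have h := ((tendsto_add_natCast_div_natCast (a + (a + b + c + d - 1))).mul
    (tendsto_sq_mul_PhiTerm a b c d)).neg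
  rw [mul_one] at h
  refine h.congr' ?_
  filter_upwards [eventually_ne_atTop 0] with n hn
  have hn' : (n : ℂ) ≠ 0 := Nat.cast_ne_zero.mpr hn
  field_simp

/-- The companion of `Phi_shift_left`, with boundary term `+1` from `k (b+c+d-1+k) t(k)`. -/
theorem Phi_shift_right {a b c d : ℂ} (hc : ∀ n : ℕ, c ≠ -(n : ℂ))
    (hd : ∀ n : ℕ, d ≠ -(n : ℂ)) (hs : ∀ n : ℕ, a + b + c + d - 1 ≠ -(n : ℂ)) :
    (a + c) * (a + d) * Phi c d (a + 1) b - a * (a + b + c + d - 1) * Phi c d a b = 1 := by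
  have s1 := (summable_PhiTerm c d (a + 1) b).mul_left ((a + c) * (a + d))
  have s2 := (summable_PhiTerm c d a b).mul_left (a * (a + b + c + d - 1))
  rw [Phi, Phi, ← tsum_mul_left, ← tsum_mul_left, ← s1.tsum_sub s2]
  refine tsum_eq_of_telescoping (s1.sub s2)
    (G := fun k : ℕ => k * (b + c + d - 1 + k) * PhiTerm c d a b k)
    (PhiTerm_telescope_right hc hd hs) (by simp) ?_
  have h := (tendsto_add_natCast_div_natCast (b + c + d - 1)).mul
    (tendsto_sq_mul_PhiTerm c d a b)
  rw [mul_one] at h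
  refine h.congr' ?_
  filter_upwards [eventually_ne_atTop 0] with n hn
  have hn' : (n : ℂ) ≠ 0 := Nat.cast_ne_zero.mpr hn
  field_simp

/-- Two solutions of the same first-order recurrence which, after multiplication by a common weight,
have the same nonzero limit are equal: they are proportional, and the limit fixes the factor. -/
theorem eq_of_recurrence_of_tendsto {A Q W x y : ℕ → ℂ} {L : ℂ} (hL : L ≠ 0)
    (hx : ∀ n, x n ≠ 0) (hA : ∀ n, x n * A (n + 1) = y n * A n)
    (hQ : ∀ n, x n * Q (n + 1) = y n * Q n)
    (hAW : Tendsto (fun n => A n * W n) atTop (𝓝 L))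
    (hQW : Tendsto (fun n => Q n * W n) atTop (𝓝 L)) : A 0 = Q 0 := by
  have h : ∀ n, A n * Q 0 = A 0 * Q n := by
    intro n
    induction n with
    | zero => ring
    | succ n ih =>
      apply mul_left_cancel₀ (hx n)
      linear_combination Q 0 * hA n - A 0 * hQ n + y n * ih
  have h1 := hAW.mul_const (Q 0)
  have h2 := hQW.const_mul (A 0)
  have h3 := tendsto_nhds_unique h1 (h2.congr fun n => by linear_combination (-W n) * h n)
  exact mul_left_cancel₀ hL (by linear_combination -h3)

/-! ### Gauss's summation theorem -/

/-- The `k`-th term of Gauss's series `∑ Γ(c+k) Γ(d+k) / (k! Γ(f+k))`. -/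
noncomputable def gaussTerm (c d f : ℂ) (k : ℕ) : ℂ :=
  Complex.Gamma (c + k) * (Complex.Gamma (1 + k))⁻¹ *
    (Complex.Gamma (d + k) * (Complex.Gamma (f + k))⁻¹)

theorem exists_norm_gaussTerm_le (c d f : ℂ) :
    ∃ C : ℝ, 0 ≤ C ∧ ∀ k : ℕ,
      ‖gaussTerm c d f k‖ ≤ C * ((k : ℝ) + 1) ^ (c.re + d.re - f.re - 1) := by
  obtain ⟨C, hC0, hC⟩ := Complex.exists_norm_Gamma_ratio_le c 1
  obtain ⟨D, hD0, hD⟩ := Complex.exists_norm_Gamma_ratio_le d f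
  refine ⟨C * D, mul_nonneg hC0 hD0, fun k => ?_⟩
  have hk : (0 : ℝ) < (k : ℝ) + 1 := by positivity
  rw [gaussTerm, norm_mul]
  refine (mul_le_mul (hC k) (hD k) (norm_nonneg _) (by positivity)).trans_eq ?_
  rw [show c.re + d.re - f.re - 1 = (c.re - (1 : ℂ).re) + (d.re - f.re) by
    simp only [Complex.one_re]; ring, Real.rpow_add hk]
  ring

theorem summable_natCast_add_one_rpow {p : ℝ} (hp : p < -1) :
    Summable fun k : ℕ => ((k : ℝ) + 1) ^ p := by
  have := (summable_nat_add_iff 1).mpr (Real.summable_nat_rpow.mpr hp)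
  simpa using this

theorem tendsto_natCast_add_one_rpow {p : ℝ} (hp : p < 0) :
    Tendsto (fun k : ℕ => ((k : ℝ) + 1) ^ p) atTop (𝓝 0) := by
  have h := (tendsto_rpow_neg_atTop (neg_pos.mpr hp)).comp
    (tendsto_atTop_add_const_right atTop (1 : ℝ) tendsto_natCast_atTop_atTop)
  simpa [Function.comp_def] using h

theorem summable_gaussTerm {c d f : ℂ} (h : c.re + d.re < f.re) : Summable (gaussTerm c d f) := by
  obtain ⟨C, -, hC⟩ := exists_norm_gaussTerm_le c d f
  exact Summable.of_norm_bounded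
    ((summable_natCast_add_one_rpow (by linarith)).mul_left C) hC

theorem Complex.add_natCast_ne_zero_of_re_pos {z : ℂ} (hz : 0 < z.re) (n : ℕ) : z + n ≠ 0 := by
  intro h
  have := congrArg Complex.re h
  simp only [Complex.add_re, Complex.natCast_re, Complex.zero_re] at this
  have : (0 : ℝ) ≤ n := n.cast_nonneg
  linarith

theorem gaussTerm_telescope {b c d : ℂ} (hc : 0 < c.re) (hd : 0 < d.re) (k : ℕ) :
    (b + c) * (b + d) * gaussTerm c d (b + c + d + 1) k - b * gaussTerm c d (b + c + d) k =
      (k + 1 : ℕ) * gaussTerm c d (b + c + d) (k + 1) - k * gaussTerm c d (b + c + d) k := by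
  have hc' := Complex.add_natCast_ne_zero_of_re_pos hc k
  have hd' := Complex.add_natCast_ne_zero_of_re_pos hd k
  have hk : (k : ℂ) + 1 ≠ 0 := Nat.cast_add_one_ne_zero k
  have e1 := Complex.inv_Gamma_one_add_natCast_succ k
  have e2 := Complex.inv_Gamma_eq_mul_inv_Gamma_add_one (b + c + d + k)
  simp only [gaussTerm, e1, e2]
  rw [add_right_comm (b + c + d) 1]
  simp only [Nat.cast_succ, ← add_assoc]
  rw [Complex.Gamma_add_one _ hc', Complex.Gamma_add_one _ hd']
  field_simp
  ring

/-- Here the boundary term `k · gaussTerm c d (b+c+d) k` is of order `k ^ (-b)` and vanishes in the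
limit. -/
theorem tsum_gaussTerm_shift {b c d : ℂ} (hb : 0 < b.re) (hc : 0 < c.re) (hd : 0 < d.re) :
    (b + c) * (b + d) * ∑' k, gaussTerm c d (b + c + d + 1) k =
      b * ∑' k, gaussTerm c d (b + c + d) k := by
  have s1 := (summable_gaussTerm (c := c) (d := d) (f := b + c + d + 1)
    (by simp; linarith)).mul_left ((b + c) * (b + d))
  have s2 := (summable_gaussTerm (c := c) (d := d) (f := b + c + d)
    (by simp; linarith)).mul_left b
  rw [← sub_eq_zero, ← tsum_mul_left, ← tsum_mul_left, ← s1.tsum_sub s2]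
  refine tsum_eq_of_telescoping (s1.sub s2)
    (G := fun k : ℕ => k * gaussTerm c d (b + c + d) k)
    (gaussTerm_telescope hc hd) (by simp) ?_
  obtain ⟨C, hC0, hC⟩ := exists_norm_gaussTerm_le c d (b + c + d)
  have h0 : Tendsto (fun k : ℕ => C * ((k : ℝ) + 1) ^ (-b.re)) atTop (𝓝 0) := by
    simpa using (tendsto_natCast_add_one_rpow (neg_neg_of_pos hb)).const_mul C
  refine squeeze_zero_norm (fun k => ?_) h0
  have hk : (0 : ℝ) < (k : ℝ) + 1 := by positivity
  rw [norm_mul, Complex.norm_natCast]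
  calc (k : ℝ) * ‖gaussTerm c d (b + c + d) k‖
      ≤ ((k : ℝ) + 1) * (C * ((k : ℝ) + 1) ^ (c.re + d.re - (b + c + d).re - 1)) :=
        mul_le_mul (by linarith) (hC k) (norm_nonneg _) hk.le
    _ = C * (((k : ℝ) + 1) ^ (1 : ℝ) * ((k : ℝ) + 1) ^ (c.re + d.re - (b + c + d).re - 1)) := by
        rw [Real.rpow_one]; ring
    _ = C * ((k : ℝ) + 1) ^ (-b.re) := by
        rw [← Real.rpow_add hk]
        congr 2
        simp only [Complex.add_re]
        ring

/-- For `Re f > 0` the modulus of `Γ(f + n) / Γ(f + n + k)`, the reciprocal of the product of the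
factors `f + n + j` with `j < k`, is largest at `n = 0`. -/
theorem norm_Gamma_ratio_add_nat_le {f : ℂ} (hf : 0 < f.re) (n k : ℕ) :
    ‖Complex.Gamma (f + n) * (Complex.Gamma (f + n + k))⁻¹‖ ≤
      ‖Complex.Gamma f * (Complex.Gamma (f + k))⁻¹‖ := by
  have hfn : 0 < (f + n).re := by
    simp only [Complex.add_re, Complex.natCast_re]; positivity
  induction k with
  | zero =>
    simp [Complex.Gamma_ne_zero_of_re_pos hf, Complex.Gamma_ne_zero_of_re_pos hfn]
  | succ k ih =>
    have h1 := Complex.add_natCast_ne_zero_of_re_pos hf k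
    have h2 := Complex.add_natCast_ne_zero_of_re_pos hfn k
    simp only [Nat.cast_succ, ← add_assoc]
    rw [Complex.Gamma_add_one _ h1, Complex.Gamma_add_one _ h2, mul_inv_rev, mul_inv_rev,
      ← mul_assoc, ← mul_assoc, norm_mul, norm_mul (_ * _), norm_inv, norm_inv (f + k)]
    refine mul_le_mul ih (inv_anti₀ (norm_pos_iff.mpr h1) ?_) (by positivity) (by positivity)
    rw [Complex.norm_eq_sqrt_sq_add_sq, Complex.norm_eq_sqrt_sq_add_sq]
    apply Real.sqrt_le_sqrt
    simp only [Complex.add_re, Complex.natCast_re, Complex.add_im, Complex.natCast_im,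
      add_zero]
    have : (0 : ℝ) ≤ n := n.cast_nonneg
    have : (0 : ℝ) ≤ k := k.cast_nonneg
    gcongr
    linarith

/-- Only the term `k = 0` survives in the limit. -/
theorem tendsto_tsum_gaussTerm_mul_Gamma {c d f : ℂ} (hf : 0 < f.re) (h : c.re + d.re < f.re) :
    Tendsto (fun n : ℕ => (∑' k, gaussTerm c d (f + n) k) * Complex.Gamma (f + n)) atTop
      (𝓝 (Complex.Gamma c * Complex.Gamma d)) := by
  have hlim : ∑' k : ℕ, (if k = 0 then Complex.Gamma c * Complex.Gamma d else 0) =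
      Complex.Gamma c * Complex.Gamma d := tsum_ite_eq 0 _
  simp_rw [← tsum_mul_right]
  rw [← hlim]
  refine tendsto_tsum_of_dominated_convergence
    (bound := fun k => ‖gaussTerm c d f k * Complex.Gamma f‖)
    ((summable_gaussTerm h).mul_right _).norm (fun k => ?_) (Eventually.of_forall fun n k => ?_)
  · split_ifs with hk
    · subst hk
      refine tendsto_const_nhds.congr fun n => ?_
      have : Complex.Gamma (f + n) ≠ 0 := Complex.Gamma_ne_zero_of_re_pos (by
        simp only [Complex.add_re, Complex.natCast_re]; positivity)
      simp only [gaussTerm, Nat.cast_zero, add_zero, Complex.Gamma_one]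
      field_simp
    · obtain ⟨C, -, hC⟩ := Complex.exists_norm_Gamma_ratio_le f (f + k)
      have h0 : Tendsto (fun n : ℕ => Complex.Gamma (f + n) * (Complex.Gamma (f + k + n))⁻¹)
          atTop (𝓝 0) := by
        refine squeeze_zero_norm hC ?_
        have hp : f.re - (f + k).re < 0 := by
          have : (0 : ℝ) < k := by positivity
          simpa using this
        simpa using (tendsto_natCast_add_one_rpow hp).const_mul C
      have h1 := h0.const_mul
        (Complex.Gamma (c + k) * (Complex.Gamma (1 + k))⁻¹ * Complex.Gamma (d + k))
      rw [mul_zero] at h1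
      refine h1.congr fun n => ?_
      rw [gaussTerm, add_right_comm f]
      ring
  · have := norm_Gamma_ratio_add_nat_le hf n k
    have e : ∀ z : ℂ, gaussTerm c d z k * Complex.Gamma z =
        (Complex.Gamma (c + k) * (Complex.Gamma (1 + k))⁻¹ * Complex.Gamma (d + k)) *
        (Complex.Gamma z * (Complex.Gamma (z + k))⁻¹) := fun z => by
      rw [gaussTerm]; ring
    rw [e, e, norm_mul, norm_mul _ (Complex.Gamma f * _)]
    exact mul_le_mul_of_nonneg_left this (norm_nonneg _)

/-- **Gauss's summation theorem** for `₂F₁(c, d; b+c+d; 1)`, for parameters with positive real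
part. -/
theorem tsum_gaussTerm {b c d : ℂ} (hb : 0 < b.re) (hc : 0 < c.re) (hd : 0 < d.re) :
    ∑' k, gaussTerm c d (b + c + d) k =
      Complex.Gamma b * Complex.Gamma c * Complex.Gamma d *
        ((Complex.Gamma (b + c))⁻¹ * (Complex.Gamma (b + d))⁻¹) := by
  have hpos : ∀ (z : ℂ), 0 < z.re → ∀ n : ℕ, 0 < (z + n).re := fun z hz n => by
    simp only [Complex.add_re, Complex.natCast_re]; positivity
  have key := eq_of_recurrence_of_tendsto
    (A := fun n : ℕ => ∑' k, gaussTerm c d (b + c + d + n) k)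
    (Q := fun n : ℕ => Complex.Gamma (b + n) * Complex.Gamma c * Complex.Gamma d *
      ((Complex.Gamma (b + c + n))⁻¹ * (Complex.Gamma (b + d + n))⁻¹))
    (W := fun n : ℕ => Complex.Gamma (b + c + d + n))
    (x := fun n : ℕ => (b + c + n) * (b + d + n))
    (y := fun n : ℕ => b + n)
    (L := Complex.Gamma c * Complex.Gamma d)
    (mul_ne_zero (Complex.Gamma_ne_zero_of_re_pos hc) (Complex.Gamma_ne_zero_of_re_pos hd))
    (fun n => mul_ne_zero
      (Complex.add_natCast_ne_zero_of_re_pos (by simp only [Complex.add_re]; linarith) n)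
      (Complex.add_natCast_ne_zero_of_re_pos (by simp only [Complex.add_re]; linarith) n))
    (fun n => by
      have := tsum_gaussTerm_shift (hpos b hb n) hc hd
      rw [show b + n + c + d = b + c + d + n by ring, show b + n + c = b + c + n by ring,
        show b + (n : ℂ) + d = b + d + n by ring] at this
      simpa only [Nat.cast_succ, ← add_assoc] using this)
    (fun n => by
      have e1 := Complex.inv_Gamma_eq_mul_inv_Gamma_add_one (b + c + n)
      have e2 := Complex.inv_Gamma_eq_mul_inv_Gamma_add_one (b + d + n)
      simp only [Nat.cast_succ, ← add_assoc]
      rw [e1, e2, Complex.Gamma_add_one _ (Complex.add_natCast_ne_zero_of_re_pos hb n)]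
      ring)
    (tendsto_tsum_gaussTerm_mul_Gamma (by simp only [Complex.add_re]; linarith)
      (by simp only [Complex.add_re]; linarith))
    (by
      have h := ((Complex.tendsto_Gamma_ratio b (b + c)).mul
        (Complex.tendsto_Gamma_ratio (b + c + d) (b + d))).const_mul
          (Complex.Gamma c * Complex.Gamma d)
      rw [mul_one, mul_one] at h
      refine h.congr' ?_
      filter_upwards [eventually_ne_atTop 0] with n hn
      have hn' : (n : ℂ) ≠ 0 := Nat.cast_ne_zero.mpr hn
      have e : (n : ℂ) ^ (b + c - b) * (n : ℂ) ^ (b + d - (b + c + d)) = 1 := by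
        rw [← Complex.cpow_add _ _ hn']
        simp
      linear_combination (Complex.Gamma c * Complex.Gamma d * Complex.Gamma (b + n) *
        (Complex.Gamma (b + c + n))⁻¹ * Complex.Gamma (b + c + d + n) *
        (Complex.Gamma (b + d + n))⁻¹) * e)
  simpa using key

/-! ### The limit `a → ∞` -/

/-- The first series, weighted by `n ^ (1 - b)`, is negligible: its `k`-th term is
`O((k+1)^(β-1) (n+k+1)^(-1-β))` with `β = Re b`, and giving away the part `(n+k+1)^(-1/2)` to the
decay in `n` still leaves the summable bound `(k+1)^(-3/2)`. -/
theorem tendsto_Phi_add_nat_mul_cpow {a b c d : ℂ} (hb : 1 ≤ b.re) :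
    Tendsto (fun n : ℕ => Phi (a + n) b c d * (n : ℂ) ^ (1 - b)) atTop (𝓝 0) := by
  obtain ⟨C₁, hC₁, h₁⟩ := Complex.exists_norm_Gamma_ratio_le b 1
  obtain ⟨C₂, hC₂, h₂⟩ := Complex.exists_norm_Gamma_ratio_le a (a + b + c)
  obtain ⟨C₃, hC₃, h₃⟩ := Complex.exists_norm_Gamma_ratio_le (a + b + c + d - 1) (a + b + d)
  set p : ℝ := -(3 / 2) with hp
  have hsum : Summable fun k : ℕ => C₁ * C₂ * C₃ * ((k : ℝ) + 1) ^ p :=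
    (summable_natCast_add_one_rpow (by norm_num [hp])).mul_left _
  have hterm : ∀ n : ℕ, n ≠ 0 → ∀ k : ℕ, ‖PhiTerm (a + n) b c d k * (n : ℂ) ^ (1 - b)‖ ≤
      C₁ * C₂ * C₃ * ((k : ℝ) + 1) ^ p * ((n : ℝ) + 1) ^ (-(1 / 2) : ℝ) := by
    intro n hn k
    have hn1 : (1 : ℝ) ≤ n := by exact_mod_cast Nat.one_le_iff_ne_zero.mpr hn
    have hk0 : (0 : ℝ) ≤ k := k.cast_nonneg
    have hM : (0 : ℝ) < (n : ℝ) + k + 1 := by positivity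
    have e : PhiTerm (a + n) b c d k =
        Complex.Gamma (b + k) * (Complex.Gamma (1 + k))⁻¹ *
        (Complex.Gamma (a + (n + k : ℕ)) * (Complex.Gamma (a + b + c + (n + k : ℕ)))⁻¹) *
        (Complex.Gamma (a + b + c + d - 1 + (n + k : ℕ)) *
          (Complex.Gamma (a + b + d + (n + k : ℕ)))⁻¹) := by
      rw [PhiTerm, div_eq_mul_inv, mul_inv, mul_inv]
      push_cast
      rw [show a + n + b + c + d - 1 + (k : ℂ) = a + b + c + d - 1 + (n + k) by ring,
        show a + n + b + c + (k : ℂ) = a + b + c + (n + k) by ring,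
        show a + n + b + d + (k : ℂ) = a + b + d + (n + k) by ring, add_assoc a]
      ring
    have b2 := h₂ (n + k)
    have b3 := h₃ (n + k)
    simp only [Nat.cast_add (R := ℝ)] at b2 b3
    have hnb : ‖(n : ℂ) ^ (1 - b)‖ ≤ 1 := by
      rw [Complex.norm_natCast_cpow_of_pos (Nat.pos_of_ne_zero hn)]
      exact Real.rpow_le_one_of_one_le_of_nonpos hn1 (by simpa using hb)
    rw [e, norm_mul, norm_mul, norm_mul]
    -- The two exponents of `n + k + 1` add up to `-1 - Re b`, split as `-(1/2 + Re b) - 1/2`.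
    calc _ ≤ C₁ * ((k : ℝ) + 1) ^ (b.re - (1 : ℂ).re) *
          (C₂ * ((n : ℝ) + k + 1) ^ (a.re - (a + b + c).re)) *
          (C₃ * ((n : ℝ) + k + 1) ^ ((a + b + c + d - 1).re - (a + b + d).re)) * 1 := by
          gcongr
          exact h₁ k
      _ = C₁ * C₂ * C₃ * (((k : ℝ) + 1) ^ (b.re - 1) *
          (((n : ℝ) + k + 1) ^ (-(1 / 2 + b.re)) * ((n : ℝ) + k + 1) ^ (-(1 / 2) : ℝ))) := by
          rw [← Real.rpow_add hM, show -(1 / 2 + b.re) + -(1 / 2) =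
            (a.re - (a + b + c).re) + ((a + b + c + d - 1).re - (a + b + d).re) by
              simp only [Complex.add_re, Complex.sub_re, Complex.one_re]; ring, Real.rpow_add hM,
            Complex.one_re]
          ring
      _ ≤ C₁ * C₂ * C₃ * (((k : ℝ) + 1) ^ (b.re - 1) *
          (((k : ℝ) + 1) ^ (-(1 / 2 + b.re)) * ((n : ℝ) + 1) ^ (-(1 / 2) : ℝ))) := by
          gcongr ?_ * (_ * (?_ * ?_))
          · exact Real.rpow_le_rpow_of_nonpos (by positivity) (by linarith) (by linarith)
          · exact Real.rpow_le_rpow_of_nonpos (by positivity) (by linarith) (by norm_num)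
      _ = _ := by
          rw [← mul_assoc (((k : ℝ) + 1) ^ _), ← Real.rpow_add (by positivity),
            show b.re - 1 + -(1 / 2 + b.re) = p by rw [hp]; ring]
          ring
  have h0 : Tendsto (fun n : ℕ => (∑' k : ℕ, C₁ * C₂ * C₃ * ((k : ℝ) + 1) ^ p) *
      ((n : ℝ) + 1) ^ (-(1 / 2) : ℝ)) atTop (𝓝 0) := by
    simpa using (tendsto_natCast_add_one_rpow (p := -(1 / 2)) (by norm_num)).const_mul
      (∑' k : ℕ, C₁ * C₂ * C₃ * ((k : ℝ) + 1) ^ p)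
  refine squeeze_zero_norm' ?_ h0
  filter_upwards [eventually_ne_atTop 0] with n hn
  rw [Phi, ← tsum_mul_right]
  exact tsum_of_norm_bounded (hsum.hasSum.mul_right _) (hterm n hn)

/-- The second series tends termwise to Gauss's series. With `β = Re b ≥ 1` the terms are dominated
through `(n+k+1)^(β-1) ≤ (2n(k+1))^(β-1)`, which against Gauss's `(k+1)^(-β-1)` leaves
`(k+1)^(-2)`. -/
theorem tendsto_Phi_right_add_nat_mul_cpow {a b c d : ℂ} (hb : 1 ≤ b.re) (hc : 0 < c.re)
    (hd : 0 < d.re) :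
    Tendsto (fun n : ℕ => Phi c d (a + n) b * (n : ℂ) ^ (1 - b)) atTop
      (𝓝 (Complex.Gamma b * Complex.Gamma c * Complex.Gamma d *
        ((Complex.Gamma (b + c))⁻¹ * (Complex.Gamma (b + d))⁻¹))) := by
  rw [← tsum_gaussTerm (by linarith) hc hd]
  simp_rw [Phi, ← tsum_mul_right]
  obtain ⟨C, hC0, hC⟩ := exists_norm_gaussTerm_le c d (b + c + d)
  obtain ⟨D, hD0, hD⟩ := Complex.exists_norm_Gamma_ratio_le (a + b + c + d - 1) (a + c + d)
  have e : ∀ n k : ℕ, PhiTerm c d (a + n) b k = gaussTerm c d (b + c + d) k *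
      (Complex.Gamma (a + b + c + d - 1 + (n + k : ℕ)) *
        (Complex.Gamma (a + c + d + (n + k : ℕ)))⁻¹) := by
    intro n k
    rw [PhiTerm, gaussTerm, div_eq_mul_inv, mul_inv, mul_inv]
    push_cast
    rw [show c + d + (a + n) + b - 1 + (k : ℂ) = a + b + c + d - 1 + (n + k) by ring,
      show c + d + (a + n) + (k : ℂ) = a + c + d + (n + k) by ring,
      show c + d + b + (k : ℂ) = b + c + d + k by ring]
    ring
  refine tendsto_tsum_of_dominated_convergence
    (bound := fun k : ℕ => C * D * 2 ^ (b.re - 1) * ((k : ℝ) + 1) ^ (-2 : ℝ))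
    ((summable_natCast_add_one_rpow (by norm_num)).mul_left _) (fun k => ?_) ?_
  · have h := (Complex.tendsto_Gamma_ratio (a + b + c + d - 1 + k) (a + c + d + k)).const_mul
      (gaussTerm c d (b + c + d) k)
    rw [mul_one] at h
    refine h.congr fun n => ?_
    rw [e, show a + c + d + k - (a + b + c + d - 1 + k) = 1 - b by ring]
    push_cast
    rw [add_assoc _ (k : ℂ), add_assoc _ (k : ℂ), add_comm (k : ℂ)]
    ring
  · filter_upwards [eventually_ne_atTop 0] with n hn k
    have hn1 : (1 : ℝ) ≤ n := by exact_mod_cast Nat.one_le_iff_ne_zero.mpr hn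
    have hn0 : (0 : ℝ) < n := by linarith
    have hk0 : (0 : ℝ) ≤ k := k.cast_nonneg
    have b2 := hD (n + k)
    simp only [Nat.cast_add (R := ℝ)] at b2
    rw [e, norm_mul, norm_mul, Complex.norm_natCast_cpow_of_pos (Nat.pos_of_ne_zero hn)]
    calc _ ≤ C * ((k : ℝ) + 1) ^ (c.re + d.re - (b + c + d).re - 1) *
          (D * ((n : ℝ) + k + 1) ^ ((a + b + c + d - 1).re - (a + c + d).re)) *
          (n : ℝ) ^ (1 - b).re := by
          gcongr
          exact hC k
      _ = C * D * (((k : ℝ) + 1) ^ (-b.re - 1) *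
          ((n : ℝ) + k + 1) ^ (b.re - 1) * (n : ℝ) ^ (1 - b.re)) := by
          rw [show c.re + d.re - (b + c + d).re - 1 = -b.re - 1 by
              simp only [Complex.add_re]; ring,
            show (a + b + c + d - 1).re - (a + c + d).re = b.re - 1 by
              simp only [Complex.add_re, Complex.sub_re, Complex.one_re]; ring,
            Complex.sub_re, Complex.one_re]
          ring
      _ ≤ C * D * (((k : ℝ) + 1) ^ (-b.re - 1) *
          (2 * n * ((k : ℝ) + 1)) ^ (b.re - 1) * (n : ℝ) ^ (1 - b.re)) := by
          gcongr
          nlinarith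
      _ = C * D * 2 ^ (b.re - 1) * (((k : ℝ) + 1) ^ (-b.re - 1) * ((k : ℝ) + 1) ^ (b.re - 1)) *
          ((n : ℝ) ^ (b.re - 1) * (n : ℝ) ^ (1 - b.re)) := by
          rw [Real.mul_rpow (by positivity) (by positivity),
            Real.mul_rpow (by positivity) (by positivity)]
          ring
      _ = _ := by
          rw [← Real.rpow_add (by positivity), ← Real.rpow_add hn0,
            show -b.re - 1 + (b.re - 1) = -2 by ring, show b.re - 1 + (1 - b.re) = 0 by ring,
            Real.rpow_zero, mul_one]

/-! ### The right-hand side -/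

/-- The product of gamma functions that evaluates `Φ(a,b;c,d) + Φ(c,d;a,b)`. -/
noncomputable def gammaProduct (a b c d : ℂ) : ℂ :=
  (Complex.Gamma a * Complex.Gamma b * Complex.Gamma c * Complex.Gamma d *
      Complex.Gamma (a + b + c + d - 1)) /
    (Complex.Gamma (a + c) * Complex.Gamma (a + d) *
      Complex.Gamma (b + c) * Complex.Gamma (b + d))

theorem gammaProduct_swap (a b c d : ℂ) : gammaProduct a b c d = gammaProduct b a c d := by
  simp only [gammaProduct]
  rw [add_comm b a]
  ring

theorem gammaProduct_swap_pairs (a b c d : ℂ) : gammaProduct a b c d = gammaProduct c d a b := by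
  simp only [gammaProduct]
  rw [add_comm c a, add_comm c b, add_comm d a, add_comm d b,
    show c + d + a + b = a + b + c + d by ring]
  ring

theorem gammaProduct_shift {a b c d : ℂ} (ha : a ≠ 0) (hs : a + b + c + d - 1 ≠ 0) :
    (a + c) * (a + d) * gammaProduct (a + 1) b c d =
      a * (a + b + c + d - 1) * gammaProduct a b c d := by
  have e1 := Complex.inv_Gamma_eq_mul_inv_Gamma_add_one (a + c)
  have e2 := Complex.inv_Gamma_eq_mul_inv_Gamma_add_one (a + d)
  simp only [gammaProduct, div_eq_mul_inv, mul_inv, e1, e2]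
  rw [show a + 1 + b + c + d - 1 = a + b + c + d - 1 + 1 by ring, add_right_comm a 1 c,
    add_right_comm a 1 d, Complex.Gamma_add_one _ ha, Complex.Gamma_add_one _ hs]
  ring

theorem tendsto_gammaProduct_add_nat_mul_cpow (a b c d : ℂ) :
    Tendsto (fun n : ℕ => gammaProduct (a + n) b c d * (n : ℂ) ^ (1 - b)) atTop
      (𝓝 (Complex.Gamma b * Complex.Gamma c * Complex.Gamma d *
        ((Complex.Gamma (b + c))⁻¹ * (Complex.Gamma (b + d))⁻¹))) := by
  have h := ((Complex.tendsto_Gamma_ratio a (a + c)).mul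
    (Complex.tendsto_Gamma_ratio (a + b + c + d - 1) (a + d))).const_mul
      (Complex.Gamma b * Complex.Gamma c * Complex.Gamma d *
        ((Complex.Gamma (b + c))⁻¹ * (Complex.Gamma (b + d))⁻¹))
  rw [mul_one, mul_one] at h
  refine h.congr' ?_
  filter_upwards [eventually_ne_atTop 0] with n hn
  have hn' : (n : ℂ) ≠ 0 := Nat.cast_ne_zero.mpr hn
  have e : (n : ℂ) ^ (1 - b) =
      (n : ℂ) ^ (a + c - a) * (n : ℂ) ^ (a + d - (a + b + c + d - 1)) := by
    rw [← Complex.cpow_add _ _ hn']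
    congr 1
    ring
  simp only [gammaProduct, div_eq_mul_inv, mul_inv, e]
  rw [show a + n + b + c + d - 1 = a + b + c + d - 1 + n by ring, add_right_comm a (n : ℂ) c,
    add_right_comm a (n : ℂ) d]
  ring

theorem Phi_add_Phi_shift {a b c d : ℂ} (ha : ∀ n : ℕ, a ≠ -(n : ℂ))
    (hb : ∀ n : ℕ, b ≠ -(n : ℂ)) (hc : ∀ n : ℕ, c ≠ -(n : ℂ)) (hd : ∀ n : ℕ, d ≠ -(n : ℂ))
    (hs : ∀ n : ℕ, a + b + c + d - 1 ≠ -(n : ℂ)) :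
    (a + c) * (a + d) * (Phi (a + 1) b c d + Phi c d (a + 1) b) =
      a * (a + b + c + d - 1) * (Phi a b c d + Phi c d a b) := by
  linear_combination Phi_shift_left ha hb hs + Phi_shift_right hc hd hs

/-! ### The evaluation -/

theorem Complex.ne_neg_natCast_of_re_pos {z : ℂ} (hz : 0 < z.re) (n : ℕ) : z ≠ -(n : ℂ) :=
  fun h => Complex.add_natCast_ne_zero_of_re_pos hz n (by rw [h, neg_add_cancel])

theorem Phi_add_Phi_of_one_le_re {a b c d : ℂ} (ha : 1 ≤ a.re) (hb : 1 ≤ b.re) (hc : 1 ≤ c.re)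
    (hd : 1 ≤ d.re) : Phi a b c d + Phi c d a b = gammaProduct a b c d := by
  have hre : ∀ n : ℕ, 1 ≤ (a + n).re := fun n => by
    have : (0 : ℝ) ≤ n := n.cast_nonneg
    simp only [Complex.add_re, Complex.natCast_re]
    linarith
  have hs : ∀ n : ℕ, 0 < (a + n + b + c + d - 1).re := fun n => by
    have := hre n
    simp only [Complex.add_re, Complex.sub_re, Complex.one_re] at this ⊢
    linarith
  have hG : ∀ {z : ℂ}, 1 ≤ z.re → Complex.Gamma z ≠ 0 := fun h =>
    Complex.Gamma_ne_zero_of_re_pos (by linarith)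
  have key := eq_of_recurrence_of_tendsto
    (A := fun n : ℕ => Phi (a + n) b c d + Phi c d (a + n) b)
    (Q := fun n : ℕ => gammaProduct (a + n) b c d)
    (W := fun n : ℕ => (n : ℂ) ^ (1 - b))
    (x := fun n : ℕ => (a + n + c) * (a + n + d))
    (y := fun n : ℕ => (a + n) * (a + n + b + c + d - 1))
    (L := Complex.Gamma b * Complex.Gamma c * Complex.Gamma d *
        ((Complex.Gamma (b + c))⁻¹ * (Complex.Gamma (b + d))⁻¹))
    (mul_ne_zero (mul_ne_zero (mul_ne_zero (hG hb) (hG hc)) (hG hd))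
      (mul_ne_zero (inv_ne_zero (hG (by simp only [Complex.add_re]; linarith)))
        (inv_ne_zero (hG (by simp only [Complex.add_re]; linarith)))))
    (fun n => by
      have := hre n
      refine mul_ne_zero ?_ ?_ <;>
      · intro h
        have := congrArg Complex.re h
        simp only [Complex.add_re, Complex.natCast_re, Complex.zero_re] at *
        linarith)
    (fun n => by
      have := Phi_add_Phi_shift (a := a + n) (b := b) (c := c) (d := d)
        (Complex.ne_neg_natCast_of_re_pos (by linarith [hre n]))
        (Complex.ne_neg_natCast_of_re_pos (by linarith))
        (Complex.ne_neg_natCast_of_re_pos (by linarith))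
        (Complex.ne_neg_natCast_of_re_pos (by linarith))
        (Complex.ne_neg_natCast_of_re_pos (hs n))
      simpa only [Nat.cast_succ, ← add_assoc] using this)
    (fun n => by
      have := gammaProduct_shift (a := a + n) (b := b) (c := c) (d := d)
        (by simpa using Complex.ne_neg_natCast_of_re_pos (lt_of_lt_of_le one_pos (hre n)) 0)
        (by simpa using Complex.ne_neg_natCast_of_re_pos (hs n) 0)
      simpa only [Nat.cast_succ, ← add_assoc] using this)
    (by
      have := (tendsto_Phi_add_nat_mul_cpow (a := a) (c := c) (d := d) hb).add
        (tendsto_Phi_right_add_nat_mul_cpow (a := a) (c := c) (d := d) hb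
          (by linarith) (by linarith))
      simpa only [zero_add, ← add_mul] using this)
    (tendsto_gammaProduct_add_nat_mul_cpow a b c d)
  simpa using key

theorem add_natCast_ne_neg_natCast {z : ℂ} (hz : ∀ n : ℕ, z ≠ -(n : ℂ)) (m n : ℕ) :
    z + m ≠ -(n : ℂ) := fun h => hz (m + n) (by push_cast; linear_combination h)

/-- The recurrence run backwards: it determines the value at `a` from the value at `a + m`, because
the factors `a + j` and `a + j + b + c + d - 1` do not vanish. -/
theorem Phi_add_Phi_of_add_nat {a b c d : ℂ} (ha : ∀ n : ℕ, a ≠ -(n : ℂ))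
    (hb : ∀ n : ℕ, b ≠ -(n : ℂ)) (hc : ∀ n : ℕ, c ≠ -(n : ℂ)) (hd : ∀ n : ℕ, d ≠ -(n : ℂ))
    (hs : ∀ n : ℕ, a + b + c + d - 1 ≠ -(n : ℂ)) (m : ℕ)
    (h : Phi (a + m) b c d + Phi c d (a + m) b = gammaProduct (a + m) b c d) :
    Phi a b c d + Phi c d a b = gammaProduct a b c d := by
  induction m with
  | zero => simpa using h
  | succ m ih =>
    apply ih
    have hs' : ∀ n : ℕ, a + m + b + c + d - 1 ≠ -(n : ℂ) := fun n => by
      have := add_natCast_ne_neg_natCast hs m n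
      rwa [show a + m + b + c + d - 1 = a + b + c + d - 1 + m by ring]
    have ha' := add_natCast_ne_neg_natCast ha m
    have ha0 : a + m ≠ 0 := by simpa using ha' 0
    have hs0 : a + m + b + c + d - 1 ≠ 0 := by simpa using hs' 0
    have e1 := Phi_add_Phi_shift ha' hb hc hd hs'
    have e2 := gammaProduct_shift ha0 hs0
    simp only [Nat.cast_succ, ← add_assoc] at h
    rw [h, e2] at e1
    exact (mul_left_cancel₀ (mul_ne_zero ha0 hs0) e1).symm

theorem exists_nat_one_le_re_add (z : ℂ) : ∃ m : ℕ, 1 ≤ (z + m).re := by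
  obtain ⟨m, hm⟩ := exists_nat_ge (1 - z.re)
  exact ⟨m, by simp only [Complex.add_re, Complex.natCast_re]; linarith⟩

theorem Phi_swap_left (a b c d : ℂ) : Phi a b c d = Phi b a c d := by
  rw [Phi, Phi, PhiTerm_swap_left]

theorem Phi_swap_right (a b c d : ℂ) : Phi a b c d = Phi a b d c := by
  rw [Phi, Phi, PhiTerm_swap_right]

theorem Phi_add_Phi_eq_gammaProduct {a b c d : ℂ} (ha : ∀ n : ℕ, a ≠ -(n : ℂ))
    (hb : ∀ n : ℕ, b ≠ -(n : ℂ)) (hc : ∀ n : ℕ, c ≠ -(n : ℂ)) (hd : ∀ n : ℕ, d ≠ -(n : ℂ))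
    (hs : ∀ n : ℕ, a + b + c + d - 1 ≠ -(n : ℂ)) :
    Phi a b c d + Phi c d a b = gammaProduct a b c d := by
  obtain ⟨i, hi⟩ := exists_nat_one_le_re_add a
  obtain ⟨j, hj⟩ := exists_nat_one_le_re_add b
  obtain ⟨k, hk⟩ := exists_nat_one_le_re_add c
  obtain ⟨l, hl⟩ := exists_nat_one_le_re_add d
  have ha' := add_natCast_ne_neg_natCast ha i
  have hb' := add_natCast_ne_neg_natCast hb j
  have hc' := add_natCast_ne_neg_natCast hc k
  refine Phi_add_Phi_of_add_nat ha hb hc hd hs i ?_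
  rw [Phi_swap_left (a + i), Phi_swap_right c d, gammaProduct_swap]
  refine Phi_add_Phi_of_add_nat hb ha' hc hd (fun n => ?_) j ?_
  · have := add_natCast_ne_neg_natCast hs i n
    rwa [show b + (a + i) + c + d - 1 = a + b + c + d - 1 + i by ring]
  rw [add_comm (Phi _ _ _ _), gammaProduct_swap_pairs]
  refine Phi_add_Phi_of_add_nat hc hd hb' ha' (fun n => ?_) k ?_
  · have := add_natCast_ne_neg_natCast hs (i + j) n
    rwa [show c + d + (b + j) + (a + i) - 1 = a + b + c + d - 1 + (i + j : ℕ) by push_cast; ring]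
  rw [Phi_swap_left (c + k), Phi_swap_right (b + j), gammaProduct_swap]
  refine Phi_add_Phi_of_add_nat hd hc' hb' ha' (fun n => ?_) l ?_
  · have := add_natCast_ne_neg_natCast hs (i + j + k) n
    rwa [show d + (c + k) + (b + j) + (a + i) - 1 = a + b + c + d - 1 + (i + j + k : ℕ) by
      push_cast; ring]
  exact Phi_add_Phi_of_one_le_re hl hk hj hi

theorem theorem1 (a b c d : ℂ)
    (ha : ∀ n : ℕ, a ≠ -(n : ℂ)) (hb : ∀ n : ℕ, b ≠ -(n : ℂ))
    (hc : ∀ n : ℕ, c ≠ -(n : ℂ)) (hd : ∀ n : ℕ, d ≠ -(n : ℂ))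
    (hs : ∀ n : ℕ, a + b + c + d - 1 ≠ -(n : ℂ)) :
    Summable (PhiTerm a b c d) ∧ Summable (PhiTerm c d a b) ∧
      Phi a b c d + Phi c d a b =
        (Complex.Gamma a * Complex.Gamma b * Complex.Gamma c * Complex.Gamma d *
            Complex.Gamma (a + b + c + d - 1)) /
          (Complex.Gamma (a + c) * Complex.Gamma (a + d) *
            Complex.Gamma (b + c) * Complex.Gamma (b + d)) :=
  ⟨summable_PhiTerm a b c d, summable_PhiTerm c d a b,
    Phi_add_Phi_eq_gammaProduct ha hb hc hd hs⟩
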